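/- Let $n\ge 2$, let $F$ be the free group on $x_1,\dots,x_n$, let $M=M_n=F/F''$ be the free metabelian group of rank $n$ (the images of the $x_i$ in $M$ are denoted by the same letters), and let $M'=[M,M]$. Let $d_j\colon F\to\mathbb Z F$ be the left Fox derivative, i.e. the map with $d_j(x_i)=\delta_{ij}$ and $d_j(uv)=d_j(u)+u\,d_j(v)$. Composing $d_j$ with the natural map $\mathbb ZF\to\mathbb Z(F/F')=\mathbb Z(M/M')$ gives a map that is constant on cosets of $F''$, hence a map $d_j^a\colon M\to\mathbb Z(M/M')$. For $r\in M'$ and $u\in\mathbb Z(M/M')$ let $r^u\in M'$ denote the result of the action of $u$ on $r$, where $g\in M/M'$ acts on the abelian group $M'$ by $r\mapsto grg^{-1}$ and this action is extended to $\mathbb Z(M/M')$ by linearity. The rank of a matrix over a commutative ring is the maximal number of its rows that are linearly independent over that ring. Let $\varphi$ be an IA-endomorphism of $M$, i.e. an endomorphism inducing the identity on $M/M'$, put $y_i=\varphi(x_i)$ for $1\le i\le n$, and let $J^a_\varphi=(d^a_j(y_i))_{1\le i,j\le n}$ be its abelianized Jacobian matrix over $\mathbb Z(M/M')$. Let $I$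 be the $n\times n$ identity matrix. Then: (i) $\det(J^a_\varphi-I)=0$. (ii) If $\operatorname{rank}(J^a_\varphi-I)\le n-2$, then $\varphi$ has a non-trivial fixed point in $M'$, i.e. there is $g\in M'$ with $g\ne 1$ and $\varphi(g)=g$. (iii) If $\operatorname{rank}(J^a_\varphi-I)=n-1$, then $\varphi$ has a non-trivial fixed point in $M'$ if and only if $$[x_1,x_2]^{u_1}[x_2,x_3]^{u_2}\cdots[x_{n-1},x_n]^{u_{n-1}}=[y_1,y_2]^{u_1}[y_2,y_3]^{u_2}\cdots[y_{n-1},y_n]^{u_{n-1}}$$ for some elements $u_1,\dots,u_{n-1}\in\mathbb Z(M/M')$, not all of them zero. -/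

import Mathlib

/-- The free metabelian group `F / F''` of rank `n`, where `F` is free on `n` generators. -/
abbrev FreeMetabelian (n : ℕ) : Type :=
  FreeGroup (Fin n) ⧸ derivedSeries (FreeGroup (Fin n)) 2

namespace FreeMetabelian

open scoped commutatorElement

/-- The free generator `x_i` of the free metabelian group. -/
def gen {n : ℕ} (i : Fin n) : FreeMetabelian n :=
  QuotientGroup.mk (FreeGroup.of i)

/-- The integral group ring `Z(M/M')` of the abelianization of the free metabelian group. -/
abbrev AbRing (n : ℕ) : Type :=
  MonoidAlgebra ℤ (Abelianization (FreeMetabelian n))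

/-- The affine permutation `v ↦ x_i * v + δ_{ij}` of the free group ring. -/
noncomputable def foxPerm {n : ℕ} (j i : Fin n) :
    Equiv.Perm (MonoidAlgebra ℤ (FreeGroup (Fin n))) where
  toFun v := MonoidAlgebra.of ℤ _ (FreeGroup.of i) * v + (if i = j then 1 else 0)
  invFun v := MonoidAlgebra.of ℤ _ (FreeGroup.of i)⁻¹ * (v - (if i = j then 1 else 0))
  left_inv v := by
    dsimp only
    rw [add_sub_cancel_right, ← mul_assoc, ← map_mul, inv_mul_cancel, map_one, one_mul]
  right_inv v := by
    dsimp only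
    rw [← mul_assoc, ← map_mul, mul_inv_cancel, map_one, one_mul, sub_add_cancel]

/-- The left Fox derivative `d_j : F → ZF`. It is the unique map with `d_j (x_i) = δ_{ij}` and
`d_j (u v) = d_j u + u * d_j v` (see `foxDeriv_of` and `foxDeriv_mul` below). It is obtained by
letting `F` act on `ZF` by affine maps `v ↦ w * v + d_j w` and evaluating at `0`. -/
noncomputable def foxDeriv {n : ℕ} (j : Fin n) (w : FreeGroup (Fin n)) :
    MonoidAlgebra ℤ (FreeGroup (Fin n)) :=
  FreeGroup.lift (foxPerm j) w 0

theorem foxDeriv_of {n : ℕ} (j i : Fin n) :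
    foxDeriv j (FreeGroup.of i) = if i = j then 1 else 0 := by
  simp [foxDeriv, foxPerm]

theorem foxPerm_lift_apply {n : ℕ} (j : Fin n) (w : FreeGroup (Fin n))
    (v : MonoidAlgebra ℤ (FreeGroup (Fin n))) :
    FreeGroup.lift (foxPerm j) w v = MonoidAlgebra.of ℤ _ w * v + foxDeriv j w := by
  unfold foxDeriv
  induction w using FreeGroup.induction_on generalizing v with
  | C1 => simp only [map_one, Equiv.Perm.one_apply, one_mul, add_zero]
  | of i => simp [foxPerm]
  | inv_of i _ =>
    rw [map_inv, FreeGroup.lift_apply_of, Equiv.Perm.inv_def]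
    simp only [foxPerm, Equiv.coe_fn_symm_mk]
    rw [← mul_add]
    congr 1
    abel
  | mul a b ha hb =>
    rw [map_mul, Equiv.Perm.mul_apply, Equiv.Perm.mul_apply, hb, ha,
      ha (FreeGroup.lift (foxPerm j) b 0), map_mul, mul_add, mul_assoc, add_assoc]

theorem foxDeriv_mul {n : ℕ} (j : Fin n) (u v : FreeGroup (Fin n)) :
    foxDeriv j (u * v) = foxDeriv j u + MonoidAlgebra.of ℤ _ u * foxDeriv j v := by
  rw [add_comm, ← foxPerm_lift_apply, foxDeriv, foxDeriv, map_mul, Equiv.Perm.mul_apply]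

/-- The abelianization `F → M → M/M'` of the free group. -/
def abHom (n : ℕ) : FreeGroup (Fin n) →* Abelianization (FreeMetabelian n) :=
  Abelianization.of.comp (QuotientGroup.mk' (derivedSeries (FreeGroup (Fin n)) 2))

/-- The ring homomorphism `ZF → Z(M/M')` induced by abelianization. -/
noncomputable def abRingHom (n : ℕ) :
    MonoidAlgebra ℤ (FreeGroup (Fin n)) →+* AbRing n :=
  MonoidAlgebra.mapDomainRingHom ℤ (abHom n)

/-- The abelianized Fox derivative `F → Z(M/M')`. -/
noncomputable def abFoxDerivFree {n : ℕ} (j : Fin n) (w : FreeGroup (Fin n)) : AbRing n :=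
  abRingHom n (foxDeriv j w)

theorem abFoxDerivFree_mul {n : ℕ} (j : Fin n) (u v : FreeGroup (Fin n)) :
    abFoxDerivFree j (u * v) =
      abFoxDerivFree j u + MonoidAlgebra.of ℤ _ (abHom n u) * abFoxDerivFree j v := by
  rw [abFoxDerivFree, foxDeriv_mul, map_add, map_mul]
  congr 2
  simp [abRingHom]

theorem abHom_eq_one {n : ℕ} {w : FreeGroup (Fin n)}
    (hw : w ∈ derivedSeries (FreeGroup (Fin n)) 1) : abHom n w = 1 := by
  rw [derivedSeries_one] at hw
  exact Abelianization.commutator_subset_ker (abHom n) hw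

/-- On `F'` the abelianized Fox derivative is a homomorphism to an abelian group. -/
noncomputable def abFoxHom {n : ℕ} (j : Fin n) :
    derivedSeries (FreeGroup (Fin n)) 1 →* Multiplicative (AbRing n) :=
  MonoidHom.mk' (fun w => Multiplicative.ofAdd (abFoxDerivFree j (w : FreeGroup (Fin n)))) (by
    intro a b
    rw [← ofAdd_add, Subgroup.coe_mul, abFoxDerivFree_mul, abHom_eq_one a.2, map_one, one_mul])

theorem abFoxDerivFree_eq_zero {n : ℕ} (j : Fin n) {w : FreeGroup (Fin n)}
    (hw : w ∈ derivedSeries (FreeGroup (Fin n)) 2) : abFoxDerivFree j w = 0 := by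
  have h : derivedSeries (FreeGroup (Fin n)) 2 ≤
      (commutator (derivedSeries (FreeGroup (Fin n)) 1)).map
        (derivedSeries (FreeGroup (Fin n)) 1).subtype := by
    rw [derivedSeries_succ, commutator_def, Subgroup.map_commutator, ← MonoidHom.range_eq_map,
      Subgroup.range_subtype]
  obtain ⟨r, hr, rfl⟩ := h hw
  exact Abelianization.commutator_subset_ker (abFoxHom j) hr

/-- The abelianized Fox derivative `d_j^a : M → Z(M/M')`: lift an element of `M = F/F''` to `F`,
take its Fox derivative and abelianize; this does not depend on the lift. -/
noncomputable def abFoxDeriv {n : ℕ} (j : Fin n) (g : FreeMetabelian n) : AbRing n :=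
  Quotient.liftOn' g (abFoxDerivFree j) (by
    intro a b hab
    rw [QuotientGroup.leftRel_apply] at hab
    have h := abFoxDerivFree_mul j a (a⁻¹ * b)
    rw [abFoxDerivFree_eq_zero j hab, mul_zero, add_zero, mul_inv_cancel_left] at h
    exact h.symm)

/-- The abelianized Jacobian matrix `(d_j^a (φ x_i))_{i,j}` of an endomorphism of `M`. -/
noncomputable def abJacobian {n : ℕ} (φ : FreeMetabelian n →* FreeMetabelian n) :
    Matrix (Fin n) (Fin n) (AbRing n) :=
  Matrix.of fun i j => abFoxDeriv j (φ (gen i))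

/-- An IA-endomorphism: an endomorphism that induces the identity on the abelianization. -/
def IsIA {G : Type*} [Group G] (φ : G →* G) : Prop :=
  Abelianization.map φ = MonoidHom.id (Abelianization G)

theorem commutator_mul_comm (n : ℕ) (a b : commutator (FreeMetabelian n)) : a * b = b * a := by
  have hbot : derivedSeries (FreeMetabelian n) 2 = ⊥ := by
    have h := map_derivedSeries_eq
      (f := QuotientGroup.mk' (derivedSeries (FreeGroup (Fin n)) 2))
      (QuotientGroup.mk'_surjective _) 2
    rw [← h, QuotientGroup.map_mk'_self]
  refine Subtype.ext ?_
  have ha : (a : FreeMetabelian n) ∈ derivedSeries (FreeMetabelian n) 1 := by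
    rw [derivedSeries_one]; exact a.2
  have hb : (b : FreeMetabelian n) ∈ derivedSeries (FreeMetabelian n) 1 := by
    rw [derivedSeries_one]; exact b.2
  have hc := Subgroup.commutator_mem_commutator ha hb
  rw [← derivedSeries_succ, hbot, Subgroup.mem_bot, commutatorElement_eq_one_iff_mul_comm] at hc
  exact hc

/-- The commutator subgroup `M'` of the free metabelian group is abelian. -/
instance commutatorCommGroup (n : ℕ) : CommGroup (commutator (FreeMetabelian n)) :=
  { (inferInstance : Group (commutator (FreeMetabelian n))) with
    mul_comm := commutator_mul_comm n }

/-- The conjugation action `g · r = g r g⁻¹` of `M` on `M'`, which factors through `M/M'`. -/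
def conjAb (n : ℕ) :
    Abelianization (FreeMetabelian n) →* MulAut (commutator (FreeMetabelian n)) :=
  QuotientGroup.lift (commutator (FreeMetabelian n)) MulAut.conjNormal (by
    intro g hg
    ext r
    have h := congrArg Subtype.val (mul_comm (⟨g, hg⟩ : commutator (FreeMetabelian n)) r)
    simp only [Subgroup.coe_mul] at h
    rw [MulAut.conjNormal_apply, h, mul_inv_cancel_right, MulAut.one_apply])

/-- The conjugation action as a homomorphism to the endomorphism ring of `M'`, written additively. -/
def conjEnd (n : ℕ) :
    Abelianization (FreeMetabelian n) →*
      AddMonoid.End (Additive (commutator (FreeMetabelian n))) where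
  toFun a := MonoidHom.toAdditive (conjAb n a).toMonoidHom
  map_one' := by rw [map_one]; rfl
  map_mul' a b := by rw [map_mul]; rfl

/-- The element `r^u` of `M'`, for `r` in `M'` and `u` in `Z(M/M')`: the conjugation action
`r ↦ g r g⁻¹` of `M/M'` on the abelian group `M'`, extended to the group ring by linearity. -/
noncomputable def ringPow {n : ℕ} (r : commutator (FreeMetabelian n)) (u : AbRing n) :
    commutator (FreeMetabelian n) :=
  (MonoidAlgebra.lift ℤ _ _ (conjEnd n) u (Additive.ofMul r)).toMul

/-- The commutator `[a, b] = a b a⁻¹ b⁻¹` as an element of `M'`. -/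
def comm {n : ℕ} (a b : FreeMetabelian n) : commutator (FreeMetabelian n) :=
  ⟨⁅a, b⁆, Subgroup.commutator_mem_commutator (Subgroup.mem_top a) (Subgroup.mem_top b)⟩

/-- The product `[y_1, y_2]^{u_1} [y_2, y_3]^{u_2} ⋯ [y_{n-1}, y_n]^{u_{n-1}}` in the abelian
group `M'`. -/
noncomputable def chainProd {n : ℕ} (y : Fin n → FreeMetabelian n) (u : Fin (n - 1) → AbRing n) :
    commutator (FreeMetabelian n) :=
  ∏ k : Fin (n - 1),
    ringPow (comm (y ⟨k, by omega⟩) (y ⟨k + 1, by omega⟩)) (u k)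

/-- The rank of a matrix over a commutative ring: the maximal number of linearly independent
rows. -/
noncomputable def rowRank {S ι κ : Type*} [CommRing S] [Fintype ι] (A : Matrix ι κ S) : ℕ :=
  sSup {k : ℕ | ∃ s : Finset ι, s.card = k ∧ LinearIndependent S (fun i : s => A i)}

end FreeMetabelian

/-!
Write `R = ℤ(M/M')`, `a_i` for the image of `x_i` in `R`, and `b = (a_i - 1)_i`. The argument
transports fixed points in `M'` to linear algebra over `R`, which is a domain because `M/M'` embeds
into `ℤⁿ` (`exponentSum_injective`).

The Magnus embedding `d : M' → Rⁿ`, `r ↦ (d_j r)_j`, is additive, `R`-linear (`magnus_ringPow`) and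
injective (`magnus_injective`). Injectivity is proved with a section `s` of `M → M/M'`: sending the
edge `(a, i)` of the Cayley graph of `M/M'` to `s(a) x_i s(a x_i)⁻¹ ∈ M'` defines an additive map
`θ : Rⁿ → M'` such that `θ(d r)` is conjugate to `r`. By the fundamental formula
(`sum_abFoxDeriv_mul`) the image of `d` is orthogonal to `b`, and conversely, if `v` is orthogonal
to `b` then `(a_0 - 1) v` is the image of `∏ [x_0, x_k]^{v_k}` (`exists_magnus_eq_smul`). By the
chain rule `d(φ r) = d(r) J` for an IA-endomorphism `φ`, so `r` is fixed if and only if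
`d(r) (J - 1) = 0` (`IsIA.map_eq_self_iff`).

* (i) The fundamental formula for `φ(x_i)` says `(J - 1) b = 0`, and `b ≠ 0`.
* (ii) If the rank is at most `n - 2`, the left kernel of `J - 1` over the fraction field has
  dimension at least two, so it meets the hyperplane orthogonal to `b`. Clearing denominators gives a
  nonzero `v ∈ Rⁿ`, and a multiple of `v` is the image of a fixed element.
* (iii) Up to a nonzero factor, any vector orthogonal to `b` is a combination of the images of
  `[x_1, x_2], …, [x_{n-1}, x_n]` (`exists_koszulChain_eq`), and these images are linearly
  independent (`koszulChain_eq_zero`). Hence nontrivial fixed points exist if and only if some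
  `[x_1, x_2]^{u_1} ⋯ [x_{n-1}, x_n]^{u_{n-1}}` with `u ≠ 0` is fixed, and `φ` maps this product to
  the one with `y_i` in place of `x_i` (`IsIA.map_chainProd`).
-/

namespace FreeMetabelian

open scoped commutatorElement

variable {n : ℕ}

theorem abelianization_of_surjective (G : Type*) [Group G] :
    Function.Surjective (Abelianization.of : G →* Abelianization G) :=
  QuotientGroup.mk'_surjective (commutator G)

theorem abelianization_of_eq_one_iff {G : Type*} [Group G] {g : G} :
    Abelianization.of g = 1 ↔ g ∈ commutator G :=
  QuotientGroup.eq_one_iff g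

/-! ### The group ring of the abelianization is a domain -/

/-- The exponent-sum homomorphism `M/M' → ℤⁿ`. -/
def exponentSum (n : ℕ) :
    Abelianization (FreeMetabelian n) →* Multiplicative (Fin n → ℤ) :=
  Abelianization.lift <| QuotientGroup.lift _
    (FreeGroup.lift fun i => Multiplicative.ofAdd (Pi.single i (1 : ℤ))) fun w hw => by
      refine Abelianization.commutator_subset_ker _ ?_
      rw [← derivedSeries_one]
      exact derivedSeries_antitone _ one_le_two hw

theorem exponentSum_gen (i : Fin n) :
    exponentSum n (Abelianization.of (gen i)) = Multiplicative.ofAdd (Pi.single i (1 : ℤ)) := by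
  simp only [exponentSum, gen, Abelianization.lift_apply_of, QuotientGroup.lift_mk,
    FreeGroup.lift_apply_of]

theorem exponentSum_injective (n : ℕ) : Function.Injective (exponentSum n) := by
  let back : Multiplicative (Fin n → ℤ) →* Abelianization (FreeMetabelian n) :=
    MonoidHom.mk' (fun f => ∏ i, Abelianization.of (gen i) ^ (f.toAdd i)) fun f g => by
      simp only [toAdd_mul, Pi.add_apply, zpow_add, Finset.prod_mul_distrib]
  have h : back.comp (exponentSum n) = MonoidHom.id _ := by
    refine Abelianization.hom_ext _ _ (QuotientGroup.monoidHom_ext _ (FreeGroup.ext_hom _ _ ?_))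
    intro i
    change back (exponentSum n (Abelianization.of (gen i))) = Abelianization.of (gen i)
    rw [exponentSum_gen]
    change ∏ k, Abelianization.of (gen k) ^ (Pi.single i (1 : ℤ) : Fin n → ℤ) k = _
    rw [Finset.prod_eq_single i]
    · simp
    · intro k _ hk
      simp [Pi.single_eq_of_ne hk]
    · simp
  exact Function.LeftInverse.injective (g := back) fun a => DFunLike.congr_fun h a

instance (n : ℕ) : UniqueProds (Abelianization (FreeMetabelian n)) :=
  UniqueProds.of_injective_mulHom (exponentSum n).toMulHom (exponentSum_injective n) inferInstance

/-- The image of `g ∈ M` in the group ring `ℤ(M/M')`. -/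
noncomputable def abOf (g : FreeMetabelian n) : AbRing n :=
  MonoidAlgebra.of ℤ _ (Abelianization.of g)

theorem abOf_mul (g h : FreeMetabelian n) : abOf (g * h) = abOf g * abOf h := by
  simp only [abOf, map_mul]

theorem abOf_eq_one {g : FreeMetabelian n} (hg : g ∈ commutator (FreeMetabelian n)) :
    abOf g = 1 := by
  rw [abOf, abelianization_of_eq_one_iff.2 hg, map_one]

theorem abOf_gen_sub_one_ne_zero (i : Fin n) : abOf (gen i) - 1 ≠ 0 := by
  intro h
  have h1 : Abelianization.of (gen i) = 1 :=
    MonoidAlgebra.of_injective (R := ℤ) (by rw [map_one]; exact sub_eq_zero.1 h)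
  have h2 := exponentSum_gen i
  rw [h1, map_one] at h2
  have h3 := congrFun (congrArg Multiplicative.toAdd h2) i
  simp at h3

/-! ### Abelianized Fox derivatives -/

theorem abFoxDeriv_mul (j : Fin n) (g h : FreeMetabelian n) :
    abFoxDeriv j (g * h) = abFoxDeriv j g + abOf g * abFoxDeriv j h := by
  induction g using QuotientGroup.induction_on with | H u =>
  induction h using QuotientGroup.induction_on with | H v =>
  exact abFoxDerivFree_mul j u v

theorem abFoxDeriv_gen (j i : Fin n) : abFoxDeriv j (gen i) = if i = j then 1 else 0 := by
  change abRingHom n (foxDeriv j (FreeGroup.of i)) = _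
  rw [foxDeriv_of]
  split_ifs <;> simp

/-- Two functions on the edge paths of the Cayley graph of `M/M'` (the path that starts at `a` and
reads the word `g`) which are additive under concatenation and agree on edges are equal. -/
theorem path_ext {X : Type*} [AddCommGroup X]
    (P Q : Abelianization (FreeMetabelian n) → FreeMetabelian n → X)
    (hP : ∀ a g h, P a (g * h) = P a g + P (a * Abelianization.of g) h)
    (hQ : ∀ a g h, Q a (g * h) = Q a g + Q (a * Abelianization.of g) h)
    (hgen : ∀ a i, P a (gen i) = Q a (gen i)) (a : Abelianization (FreeMetabelian n))
    (g : FreeMetabelian n) : P a g = Q a g := by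
  have one : ∀ T : Abelianization (FreeMetabelian n) → FreeMetabelian n → X,
      (∀ a g h, T a (g * h) = T a g + T (a * Abelianization.of g) h) → ∀ a, T a 1 = 0 := by
    intro T hT a
    have h := hT a 1 1
    rwa [mul_one, map_one, mul_one, left_eq_add] at h
  induction g using QuotientGroup.induction_on with | H w =>
  induction w using FreeGroup.induction_on generalizing a with
  | C1 =>
    change P a 1 = Q a 1
    rw [one P hP, one Q hQ]
  | of i => exact hgen a i
  | inv_of i _ =>
    change P a (gen i)⁻¹ = Q a (gen i)⁻¹
    -- Split the trivial path `x_i x_i⁻¹` that starts at `a x_i⁻¹`.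
    have h1 := hP (a * (Abelianization.of (gen i))⁻¹) (gen i) (gen i)⁻¹
    have h2 := hQ (a * (Abelianization.of (gen i))⁻¹) (gen i) (gen i)⁻¹
    rw [mul_inv_cancel, inv_mul_cancel_right, one P hP] at h1
    rw [mul_inv_cancel, inv_mul_cancel_right, one Q hQ, ← hgen] at h2
    exact add_left_cancel (h1.symm.trans h2)
  | mul u v hu hv =>
    change P a ((u : FreeMetabelian n) * (v : FreeMetabelian n)) = Q a (u * v)
    rw [hP, hQ, hu, hv]

/-- A crossed homomorphism `M → ℤ(M/M')` is determined by its values on the generators, through the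
Fox derivatives. -/
theorem crossedHom_eq_sum (f : FreeMetabelian n → AbRing n)
    (hf : ∀ g h, f (g * h) = f g + abOf g * f h) (g : FreeMetabelian n) :
    f g = ∑ i, abFoxDeriv i g * f (gen i) := by
  have h := path_ext (fun a g => MonoidAlgebra.of ℤ _ a * f g)
    (fun a g => MonoidAlgebra.of ℤ _ a * ∑ i, abFoxDeriv i g * f (gen i))
    (fun a g h => by rw [hf, abOf, map_mul]; ring)
    (fun a g h => by
      simp only [abFoxDeriv_mul, abOf, map_mul, add_mul, Finset.sum_add_distrib, mul_assoc,
        ← Finset.mul_sum, mul_add])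
    (fun a i => by simp [abFoxDeriv_gen]) 1 g
  simpa only [map_one, one_mul] using h

/-- The fundamental formula of Fox calculus. -/
theorem sum_abFoxDeriv_mul (g : FreeMetabelian n) :
    ∑ i, abFoxDeriv i g * (abOf (gen i) - 1) = abOf g - 1 :=
  (crossedHom_eq_sum (fun g => abOf g - 1) (fun g h => by rw [abOf_mul]; ring) g).symm

theorem IsIA.abelianization_of {G : Type*} [Group G] {φ : G →* G} (hφ : IsIA φ) (g : G) :
    Abelianization.of (φ g) = Abelianization.of g := by
  have h := DFunLike.congr_fun hφ (Abelianization.of g)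
  rwa [Abelianization.map_of] at h

theorem IsIA.abOf {φ : FreeMetabelian n →* FreeMetabelian n} (hφ : IsIA φ)
    (g : FreeMetabelian n) : FreeMetabelian.abOf (φ g) = FreeMetabelian.abOf g := by
  rw [FreeMetabelian.abOf, hφ.abelianization_of, FreeMetabelian.abOf]

theorem IsIA.map_mem_commutator {φ : FreeMetabelian n →* FreeMetabelian n} (hφ : IsIA φ)
    {g : FreeMetabelian n} (hg : g ∈ commutator (FreeMetabelian n)) :
    φ g ∈ commutator (FreeMetabelian n) :=
  abelianization_of_eq_one_iff.1
    ((hφ.abelianization_of g).trans (abelianization_of_eq_one_iff.2 hg))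

/-- The chain rule for an IA-endomorphism. -/
theorem IsIA.abFoxDeriv_map {φ : FreeMetabelian n →* FreeMetabelian n} (hφ : IsIA φ) (j : Fin n)
    (g : FreeMetabelian n) :
    abFoxDeriv j (φ g) = ∑ i, abFoxDeriv i g * abFoxDeriv j (φ (gen i)) :=
  crossedHom_eq_sum (fun g => abFoxDeriv j (φ g))
    (fun g h => by rw [map_mul, abFoxDeriv_mul, hφ.abOf]) g

/-! ### The Magnus embedding -/

/-- The Magnus embedding `M' → ℤ(M/M')ⁿ`, `r ↦ (d_1^a r, …, d_n^a r)`. -/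
noncomputable def magnus (n : ℕ) :
    Additive (commutator (FreeMetabelian n)) →+ (Fin n → AbRing n) where
  toFun r j := abFoxDeriv j (r.toMul : FreeMetabelian n)
  map_zero' := by
    funext j
    have h := abFoxDeriv_mul j (1 : FreeMetabelian n) 1
    rwa [mul_one, abOf_eq_one (one_mem _), one_mul, left_eq_add] at h
  map_add' r s := by
    funext j
    rw [toMul_add, Subgroup.coe_mul, abFoxDeriv_mul, abOf_eq_one r.toMul.2, one_mul]
    rfl

theorem magnus_apply (r : commutator (FreeMetabelian n)) (j : Fin n) :
    magnus n (Additive.ofMul r) j = abFoxDeriv j (r : FreeMetabelian n) := rfl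

/-- For a section `s` of `M → M/M'`, the element `s(a) g s(a ḡ)⁻¹` of `M'`: the loop obtained from
the path that starts at `a` and reads `g`. -/
def pathLoop (s : Abelianization (FreeMetabelian n) → FreeMetabelian n)
    (hs : ∀ a, Abelianization.of (s a) = a) (a : Abelianization (FreeMetabelian n))
    (g : FreeMetabelian n) : commutator (FreeMetabelian n) :=
  ⟨s a * g * (s (a * Abelianization.of g))⁻¹, abelianization_of_eq_one_iff.1 <| by
    rw [map_mul, map_mul, map_inv, hs, hs, mul_inv_cancel]⟩

/-- The Magnus embedding is injective. Sending the edge `(a, i)` of the Cayley graph of `M/M'` to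
the loop `s(a) x_i s(a x_i)⁻¹` extends to an additive map `θ : ℤ(M/M')ⁿ → M'`, and `θ` sends
`a · d(g)` to the loop of the path `(a, g)`; hence `θ(d(r))` is a conjugate of `r ∈ M'`. -/
theorem magnus_injective (n : ℕ) : Function.Injective (magnus n) := by
  rw [injective_iff_map_eq_zero]
  intro r hr
  obtain ⟨s, hs⟩ : ∃ s : Abelianization (FreeMetabelian n) → FreeMetabelian n,
      ∀ a, Abelianization.of (s a) = a :=
    ⟨_, Function.surjInv_eq (abelianization_of_surjective _)⟩
  let θ (i : Fin n) : AbRing n →+ Additive (commutator (FreeMetabelian n)) :=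
    (Finsupp.linearCombination ℤ fun a =>
      Additive.ofMul (pathLoop s hs a (gen i))).toAddMonoidHom.comp
        MonoidAlgebra.coeffAddEquiv.toAddMonoidHom
  have hθ (i a) : θ i (MonoidAlgebra.of ℤ _ a) = Additive.ofMul (pathLoop s hs a (gen i)) := by
    change Finsupp.linearCombination ℤ _ (Finsupp.single a 1) = _
    rw [Finsupp.linearCombination_single, one_smul]
  have h := path_ext (fun a g => ∑ i, θ i (MonoidAlgebra.of ℤ _ a * abFoxDeriv i g))
    (fun a g => Additive.ofMul (pathLoop s hs a g))
    (fun a g h => by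
      simp only [abFoxDeriv_mul, abOf, map_mul, mul_add, map_add, Finset.sum_add_distrib,
        mul_assoc])
    (fun a g h => by
      rw [← ofMul_mul]
      refine congrArg _ (Subtype.ext ?_)
      simp only [pathLoop, Subgroup.coe_mul, map_mul, mul_assoc, inv_mul_cancel_left])
    (fun a i => by
      rw [Finset.sum_eq_single i]
      · rw [abFoxDeriv_gen, if_pos rfl, mul_one, hθ]
      · intro k _ hk
        rw [abFoxDeriv_gen, if_neg hk.symm, mul_zero, map_zero]
      · simp) 1 (r.toMul : FreeMetabelian n)
  have h0 (i) : abFoxDeriv i (r.toMul : FreeMetabelian n) = 0 := congrFun hr i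
  simp only [h0, mul_zero, map_zero, Finset.sum_const_zero] at h
  have h1 : s 1 * (r.toMul : FreeMetabelian n) * (s (1 * Abelianization.of _))⁻¹ = 1 :=
    congrArg (fun x : Additive (commutator (FreeMetabelian n)) =>
      (x.toMul : FreeMetabelian n)) h.symm
  rw [abelianization_of_eq_one_iff.2 r.toMul.2, mul_one, conj_eq_one_iff] at h1
  exact Subtype.ext h1

theorem magnus_ringPow (r : commutator (FreeMetabelian n)) (u : AbRing n) :
    magnus n (Additive.ofMul (ringPow r u)) = u • magnus n (Additive.ofMul r) := by
  have conj (g : FreeMetabelian n) :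
      magnus n (conjEnd n (Abelianization.of g) (Additive.ofMul r)) =
        abOf g • magnus n (Additive.ofMul r) := by
    funext j
    change abFoxDeriv j (g * r * g⁻¹) = abOf g * abFoxDeriv j r
    have h := abFoxDeriv_mul j (g * r * g⁻¹) g
    rw [inv_mul_cancel_right, abFoxDeriv_mul,
      abOf_eq_one (Subgroup.Normal.conj_mem inferInstance _ r.2 g)] at h
    linear_combination -h
  change magnus n (MonoidAlgebra.lift ℤ _ _ (conjEnd n) u (Additive.ofMul r)) = _
  induction u using MonoidAlgebra.induction_linear with
  | zero => rw [map_zero, zero_smul]; exact map_zero _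
  | add u v hu hv =>
    rw [map_add, add_smul, ← hu, ← hv]
    exact map_add (magnus n) _ _
  | single a k =>
    obtain ⟨g, rfl⟩ := abelianization_of_surjective _ a
    rw [MonoidAlgebra.lift_single]
    change magnus n (k • conjEnd n (Abelianization.of g) (Additive.ofMul r)) = _
    rw [map_zsmul, conj, ← smul_assoc]
    congr 1
    change k • MonoidAlgebra.single _ 1 = _
    rw [MonoidAlgebra.smul_single, smul_eq_mul, mul_one]

theorem magnus_comm (a b : FreeMetabelian n) (j : Fin n) :
    magnus n (Additive.ofMul (comm a b)) j =
      (abOf a - 1) * abFoxDeriv j b - (abOf b - 1) * abFoxDeriv j a := by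
  change abFoxDeriv j ⁅a, b⁆ = _
  have h := abFoxDeriv_mul j ⁅a, b⁆ (b * a)
  rw [show ⁅a, b⁆ * (b * a) = a * b by rw [commutatorElement_def]; group, abFoxDeriv_mul,
    show abOf ⁅a, b⁆ = 1 from abOf_eq_one (comm a b).2, one_mul, abFoxDeriv_mul] at h
  linear_combination -h

theorem magnus_prod_ringPow {ι : Type*} [Fintype ι] (r : ι → commutator (FreeMetabelian n))
    (u : ι → AbRing n) :
    magnus n (Additive.ofMul (∏ k, ringPow (r k) (u k))) =
      ∑ k, u k • magnus n (Additive.ofMul (r k)) := by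
  rw [ofMul_prod, map_sum]
  exact Finset.sum_congr rfl fun k _ => magnus_ringPow _ _

end FreeMetabelian

/-! ### Linear algebra over a domain -/

/-- A matrix over a domain whose row rank is at most the number of rows minus two has a nonzero
left null vector orthogonal to any prescribed vector. -/
theorem FreeMetabelian.exists_vecMul_eq_zero_of_rowRank {R ι κ : Type*} [CommRing R] [IsDomain R]
    [Fintype ι] [Fintype κ] (A : Matrix ι κ R) (b : ι → R)
    (h : rowRank A + 2 ≤ Fintype.card ι) :
    ∃ v : ι → R, v ≠ 0 ∧ Matrix.vecMul v A = 0 ∧ v ⬝ᵥ b = 0 := by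
  classical
  let K := FractionRing R
  let f : R →+* K := algebraMap R K
  have hf : Function.Injective f := IsFractionRing.injective R K
  let B : Matrix ι κ K := A.map f
  have hrank : B.rank ≤ rowRank A := by
    obtain ⟨τ, a, ha, hspan, hli⟩ := exists_linearIndependent' K B.row
    have : Finite τ := Finite.of_injective a ha
    have : Fintype τ := Fintype.ofFinite τ
    have hB : B.rank = Fintype.card τ := by
      rw [Matrix.rank_eq_finrank_span_row, ← hspan, finrank_span_eq_card hli]
    rw [hB]
    refine le_csSup ⟨Fintype.card ι, ?_⟩ ⟨Finset.univ.map ⟨a, ha⟩, ?_, ?_⟩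
    · rintro k ⟨s, rfl, -⟩
      exact Finset.card_le_univ s
    · rw [Finset.card_map, Finset.card_univ]
    · have hliR : LinearIndependent R (A.row ∘ a) := by
        have h1 : LinearIndependent R (B.row ∘ a) := hli.restrict_scalars' R
        refine LinearIndependent.of_comp ((Algebra.linearMap R K).compLeft κ) ?_
        exact h1
      let e : τ ≃ (Finset.univ.map ⟨a, ha⟩ : Finset ι) := Equiv.ofBijective
        (fun t => ⟨a t, by simp⟩) ⟨fun t t' h => ha (congrArg Subtype.val h), fun ⟨i, hi⟩ => by
          obtain ⟨t, -, rfl⟩ := Finset.mem_map.1 hi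
          exact ⟨t, rfl⟩⟩
      exact (linearIndependent_equiv e).1 hliR
  have hker : 2 ≤ Module.finrank K (LinearMap.ker B.vecMulLinear) := by
    have h1 := B.vecMulLinear.finrank_range_add_finrank_ker
    rw [range_vecMulLinear, ← Matrix.rank_eq_finrank_span_row,
      Module.finrank_fintype_fun_eq_card] at h1
    omega
  let g : LinearMap.ker B.vecMulLinear →ₗ[K] K :=
    (Fintype.linearCombination K (fun i => f (b i))).comp (Submodule.subtype _)
  have hg : LinearMap.ker g ≠ ⊥ :=
    LinearMap.ker_ne_bot_of_finrank_lt (by rw [Module.finrank_self]; omega)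
  obtain ⟨w, hw, hw0⟩ := (Submodule.ne_bot_iff _).1 hg
  obtain ⟨c, hc⟩ := IsLocalization.exist_integer_multiples_of_finite (nonZeroDivisors R)
    (w : ι → K)
  choose v hv using hc
  have hv' : ∀ i, f (v i) = f c * (w : ι → K) i := fun i => by
    rw [hv, Algebra.smul_def]
  have hc0 : f c ≠ 0 := by
    rw [Ne, map_eq_zero_iff f hf]
    exact nonZeroDivisors.ne_zero c.2
  refine ⟨v, ?_, ?_, ?_⟩
  · rintro rfl
    refine hw0 (Subtype.ext (funext fun i => ?_))
    have h1 := hv' i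
    rw [Pi.zero_apply, map_zero, eq_comm, mul_eq_zero] at h1
    exact h1.resolve_left hc0
  · funext j
    have h1 : ∑ i, (w : ι → K) i * f (A i j) = 0 := congrFun (LinearMap.mem_ker.1 w.2) j
    refine hf ?_
    rw [Pi.zero_apply, map_zero, Matrix.vecMul, dotProduct, map_sum]
    simp only [map_mul, hv', mul_assoc]
    rw [← Finset.mul_sum, h1, mul_zero]
  · have h1 : ∑ i, (w : ι → K) i * f (b i) = 0 := LinearMap.mem_ker.1 hw
    refine hf ?_
    rw [map_zero, dotProduct, map_sum]
    simp only [map_mul, hv', mul_assoc]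
    rw [← Finset.mul_sum, h1, mul_zero]

namespace FreeMetabelian

open scoped commutatorElement

/-- The combination `∑ u_k (b_k e_{k+1} - b_{k+1} e_k)` of the Koszul relations between consecutive
entries of `b`. -/
def koszulChain {R : Type*} [CommRing R] {m : ℕ} (b : Fin (m + 1) → R) (u : Fin m → R)
    (j : Fin (m + 1)) : R :=
  ∑ k : Fin m, u k * (b k.castSucc * (if k.succ = j then 1 else 0) -
    b k.succ * (if k.castSucc = j then 1 else 0))

section koszulChain

variable {R : Type*} [CommRing R] {m : ℕ}

theorem koszulChain_zero (b : Fin (m + 2) → R) (u : Fin (m + 1) → R) :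
    koszulChain b u 0 = -(u 0 * b 1) := by
  rw [koszulChain, Fin.sum_univ_succ, Finset.sum_eq_zero]
  · simp
  · intro k _
    rw [if_neg (Fin.succ_ne_zero _), if_neg, mul_zero, mul_zero, sub_zero, mul_zero]
    rw [← Fin.succ_castSucc]
    exact Fin.succ_ne_zero _

theorem koszulChain_succ (b : Fin (m + 2) → R) (u : Fin (m + 1) → R) (j : Fin (m + 1)) :
    koszulChain b u j.succ =
      u 0 * (b 0 * (if 0 = j then 1 else 0)) + koszulChain (Fin.tail b) (Fin.tail u) j := by
  rw [koszulChain, Fin.sum_univ_succ, koszulChain]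
  congr 1
  · rw [Fin.castSucc_zero, if_neg (Fin.succ_ne_zero j).symm, mul_zero, sub_zero]
    simp only [Fin.succ_inj]
  · simp only [Fin.succ_inj, ← Fin.succ_castSucc, Fin.tail]

theorem koszulChain_eq_zero [IsDomain R] (b : Fin (m + 1) → R) (hb : ∀ i, b i ≠ 0)
    (u : Fin m → R) (h : ∀ j, koszulChain b u j = 0) : u = 0 := by
  induction m with
  | zero => exact Subsingleton.elim _ _
  | succ m ih =>
    have h0 : u 0 = 0 := by
      have := h 0
      rw [koszulChain_zero, neg_eq_zero, mul_eq_zero] at this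
      exact this.resolve_right (hb 1)
    have h1 := ih (Fin.tail b) (fun i => hb i.succ) (Fin.tail u) fun j => by
      have := h j.succ
      rwa [koszulChain_succ, h0, zero_mul, zero_add] at this
    funext i
    refine Fin.cases h0 (fun k => congrFun h1 k) i

/-- Up to a nonzero factor, every vector orthogonal to `b` is a combination of the Koszul relations
between consecutive entries of `b`. -/
theorem exists_koszulChain_eq [IsDomain R] (b : Fin (m + 1) → R) (hb : ∀ i, b i ≠ 0)
    (v : Fin (m + 1) → R) (hv : ∑ i, v i * b i = 0) :
    ∃ c : R, c ≠ 0 ∧ ∃ u : Fin m → R, ∀ j, koszulChain b u j = c * v j := by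
  induction m with
  | zero =>
    refine ⟨1, one_ne_zero, 0, fun j => ?_⟩
    rw [Fin.sum_univ_one, mul_eq_zero] at hv
    rw [Fin.fin_one_eq_zero j, hv.resolve_right (hb 0), mul_zero]
    simp [koszulChain]
  | succ m ih =>
    -- The combination of `v` and of the first relation whose entry at `0` vanishes.
    let t : Fin (m + 1) → R := fun j => b 1 * v j.succ + v 0 * (b 0 * (if 0 = j then 1 else 0))
    obtain ⟨c, hc, u, hu⟩ := ih (Fin.tail b) (fun i => hb i.succ) t (by
      rw [Fin.sum_univ_succ] at hv
      simp only [t, add_mul, Finset.sum_add_distrib, mul_assoc, ← Finset.mul_sum, ite_mul, one_mul,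
        zero_mul, mul_ite, mul_zero, Finset.sum_ite_eq, Finset.mem_univ, if_true, Fin.tail,
        Fin.succ_zero_eq_one]
      linear_combination b 1 * hv)
    refine ⟨c * b 1, mul_ne_zero hc (hb 1), Fin.cons (-(c * v 0)) u, fun j => ?_⟩
    refine Fin.cases ?_ (fun j => ?_) j
    · rw [koszulChain_zero, Fin.cons_zero]
      ring
    · rw [koszulChain_succ, Fin.cons_zero, Fin.tail_cons, hu]
      simp only [t]
      ring

end koszulChain

/-! ### Fixed points in the commutator subgroup -/

variable {n : ℕ}

/-- An element of `M'` is fixed by an IA-endomorphism `φ` if and only if its Magnus image is a left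
null vector of `J_φ - 1`. -/
theorem IsIA.map_eq_self_iff {φ : FreeMetabelian n →* FreeMetabelian n} (hφ : IsIA φ)
    (r : commutator (FreeMetabelian n)) :
    φ r = r ↔ Matrix.vecMul (magnus n (Additive.ofMul r)) (abJacobian φ - 1) = 0 := by
  have h : magnus n (Additive.ofMul ⟨φ r, hφ.map_mem_commutator r.2⟩) =
      Matrix.vecMul (magnus n (Additive.ofMul r)) (abJacobian φ) := by
    funext j
    exact hφ.abFoxDeriv_map j r
  rw [Matrix.vecMul_sub, Matrix.vecMul_one, sub_eq_zero, ← h, (magnus_injective n).eq_iff,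
    Additive.ofMul.apply_eq_iff_eq, Subtype.ext_iff]

theorem magnus_ne_zero {g : FreeMetabelian n} (hg : g ∈ commutator (FreeMetabelian n))
    (h : g ≠ 1) : magnus n (Additive.ofMul ⟨g, hg⟩) ≠ 0 := by
  rw [Ne, map_eq_zero_iff _ (magnus_injective n)]
  intro h0
  exact h (congrArg Subtype.val (Additive.ofMul.injective h0))

theorem ne_one_of_magnus_ne_zero {r : commutator (FreeMetabelian n)}
    (h : magnus n (Additive.ofMul r) ≠ 0) : (r : FreeMetabelian n) ≠ 1 := by
  intro h1
  rw [show r = 1 from Subtype.ext h1] at h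
  exact h (map_zero _)

theorem magnus_mul_sum (r : commutator (FreeMetabelian n)) :
    ∑ i, magnus n (Additive.ofMul r) i * (abOf (gen i) - 1) = 0 :=
  (sum_abFoxDeriv_mul (r : FreeMetabelian n)).trans (by rw [abOf_eq_one r.2, sub_self])

/-- The Jacobian matrix of an IA-endomorphism fixes the vector `(x_i - 1)_i`. -/
theorem IsIA.mulVec_eq_zero {φ : FreeMetabelian n →* FreeMetabelian n} (hφ : IsIA φ) :
    Matrix.mulVec (abJacobian φ - 1) (fun i => FreeMetabelian.abOf (gen i) - 1) = 0 := by
  rw [Matrix.sub_mulVec, Matrix.one_mulVec, sub_eq_zero]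
  funext i
  exact (sum_abFoxDeriv_mul (φ (gen i))).trans (by rw [hφ.abOf])

theorem IsIA.det_eq_zero {φ : FreeMetabelian n →* FreeMetabelian n} (hφ : IsIA φ) (i : Fin n) :
    (abJacobian φ - 1).det = 0 :=
  Matrix.exists_mulVec_eq_zero_iff.1
    ⟨_, fun h => abOf_gen_sub_one_ne_zero i (congrFun h i), hφ.mulVec_eq_zero⟩

theorem magnus_comm_gen (i k j : Fin n) :
    magnus n (Additive.ofMul (comm (gen i) (gen k))) j =
      (abOf (gen i) - 1) * (if k = j then 1 else 0) -
        (abOf (gen k) - 1) * (if i = j then 1 else 0) := by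
  rw [magnus_comm, abFoxDeriv_gen, abFoxDeriv_gen]

/-- Up to the factor `x_i - 1`, every vector orthogonal to `(x_k - 1)_k` is in the image of the
Magnus embedding. -/
theorem exists_magnus_eq_smul (i : Fin n) (v : Fin n → AbRing n)
    (hv : v ⬝ᵥ (fun k => abOf (gen k) - 1) = 0) :
    ∃ r, magnus n (Additive.ofMul r) = (abOf (gen i) - 1) • v := by
  refine ⟨∏ k, ringPow (comm (gen i) (gen k)) (v k), ?_⟩
  rw [magnus_prod_ringPow]
  funext j
  simp only [Finset.sum_apply, Pi.smul_apply, smul_eq_mul, magnus_comm_gen, mul_sub,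
    Finset.sum_sub_distrib]
  simp only [← mul_assoc, ← Finset.sum_mul]
  rw [show ∑ k, v k * (abOf (gen k) - 1) = 0 from hv, zero_mul, sub_zero]
  simp [mul_comm]

theorem magnus_chainProd {m : ℕ} (y : Fin (m + 1) → FreeMetabelian (m + 1))
    (u : Fin m → AbRing (m + 1)) :
    magnus (m + 1) (Additive.ofMul (chainProd y u)) =
      ∑ k : Fin m, u k • magnus (m + 1) (Additive.ofMul (comm (y k.castSucc) (y k.succ))) :=
  magnus_prod_ringPow _ _

theorem magnus_chainProd_gen {m : ℕ} (u : Fin m → AbRing (m + 1)) :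
    magnus (m + 1) (Additive.ofMul (chainProd gen u)) =
      koszulChain (fun i => abOf (gen i) - 1) u := by
  rw [magnus_chainProd]
  funext j
  simp only [Finset.sum_apply, Pi.smul_apply, smul_eq_mul, magnus_comm_gen, koszulChain]

/-- An IA-endomorphism maps `[y_1, y_2]^{u_1} ⋯` to `[φ y_1, φ y_2]^{u_1} ⋯`: it leaves the exponents
unchanged because it acts trivially on `M/M'`. -/
theorem IsIA.map_chainProd {m : ℕ} {φ : FreeMetabelian (m + 1) →* FreeMetabelian (m + 1)}
    (hφ : IsIA φ) (y : Fin (m + 1) → FreeMetabelian (m + 1)) (u : Fin m → AbRing (m + 1)) :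
    φ (chainProd y u : commutator (FreeMetabelian (m + 1))) = chainProd (fun i => φ (y i)) u := by
  suffices h : (⟨φ (chainProd y u : commutator _), hφ.map_mem_commutator (Subtype.prop _)⟩ :
      commutator (FreeMetabelian (m + 1))) = chainProd (fun i => φ (y i)) u from
    congrArg Subtype.val h
  refine Additive.ofMul.injective (magnus_injective _ (funext fun j => ?_))
  have hd (r : commutator (FreeMetabelian (m + 1))) : abFoxDeriv j (φ r) =
      ∑ i, magnus _ (Additive.ofMul r) i * abFoxDeriv j (φ (gen i)) := hφ.abFoxDeriv_map j r
  have hc (k : Fin m) : magnus _ (Additive.ofMul (comm (φ (y k.castSucc)) (φ (y k.succ)))) j =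
      ∑ i, magnus _ (Additive.ofMul (comm (y k.castSucc) (y k.succ))) i *
        abFoxDeriv j (φ (gen i)) := by
    rw [← hd, magnus_apply]
    change abFoxDeriv j ⁅_, _⁆ = abFoxDeriv j (φ ⁅_, _⁆)
    rw [map_commutatorElement]
  rw [magnus_apply, hd, magnus_chainProd, magnus_chainProd]
  simp only [Finset.sum_apply, Pi.smul_apply, smul_eq_mul, hc, Finset.sum_mul, Finset.mul_sum,
    mul_assoc]
  exact Finset.sum_comm

end FreeMetabelian

theorem theorem1p1 (n : ℕ) (hn : 2 ≤ n)
    (φ : FreeMetabelian n →* FreeMetabelian n) (hφ : FreeMetabelian.IsIA φ) :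
    (FreeMetabelian.abJacobian φ - 1).det = 0 ∧
    (FreeMetabelian.rowRank (FreeMetabelian.abJacobian φ - 1) ≤ n - 2 →
      ∃ g ∈ commutator (FreeMetabelian n), g ≠ 1 ∧ φ g = g) ∧
    (FreeMetabelian.rowRank (FreeMetabelian.abJacobian φ - 1) = n - 1 →
      ((∃ g ∈ commutator (FreeMetabelian n), g ≠ 1 ∧ φ g = g) ↔
        ∃ u : Fin (n - 1) → FreeMetabelian.AbRing n, u ≠ 0 ∧
          FreeMetabelian.chainProd FreeMetabelian.gen u =
            FreeMetabelian.chainProd (fun i => φ (FreeMetabelian.gen i)) u)) := by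
  open FreeMetabelian in
  obtain ⟨m, rfl⟩ : ∃ m, n = m + 1 := ⟨n - 1, by omega⟩
  refine ⟨hφ.det_eq_zero 0, fun hrank => ?_, fun _ => ⟨?_, ?_⟩⟩
  · obtain ⟨v, hv0, hvJ, hvb⟩ := exists_vecMul_eq_zero_of_rowRank (abJacobian φ - 1)
      (fun i => abOf (gen i) - 1) (by rw [Fintype.card_fin]; omega)
    obtain ⟨r, hr⟩ := exists_magnus_eq_smul 0 v hvb
    refine ⟨r, r.2, ne_one_of_magnus_ne_zero ?_, (hφ.map_eq_self_iff r).2 ?_⟩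
    · rw [hr]
      exact smul_ne_zero (abOf_gen_sub_one_ne_zero 0) hv0
    · rw [hr, Matrix.smul_vecMul, hvJ, smul_zero]
  · rintro ⟨g, hg, hg1, hfix⟩
    have hg0 := magnus_ne_zero hg hg1
    obtain ⟨c, hc, u, hu⟩ := exists_koszulChain_eq (fun i => abOf (gen i) - 1)
      abOf_gen_sub_one_ne_zero _ (magnus_mul_sum ⟨g, hg⟩)
    have hu' : magnus (m + 1) (Additive.ofMul (chainProd gen u)) =
        c • magnus (m + 1) (Additive.ofMul ⟨g, hg⟩) := by
      rw [magnus_chainProd_gen]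
      exact funext hu
    refine ⟨u, ?_, ?_⟩
    · rintro rfl
      refine smul_ne_zero hc hg0 ?_
      rw [← hu', magnus_chainProd]
      simp
    · refine Subtype.ext ?_
      rw [← hφ.map_chainProd]
      refine ((hφ.map_eq_self_iff _).2 ?_).symm
      rw [hu', Matrix.smul_vecMul, (hφ.map_eq_self_iff ⟨g, hg⟩).1 hfix, smul_zero]
  · rintro ⟨u, hu0, hu⟩
    refine ⟨_, (chainProd gen u).2, ne_one_of_magnus_ne_zero fun h => hu0 ?_, ?_⟩
    · rw [magnus_chainProd_gen] at h
      exact koszulChain_eq_zero _ abOf_gen_sub_one_ne_zero u (congrFun h)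
    · rw [hφ.map_chainProd]
      exact (congrArg Subtype.val hu).symm
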